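/- **Setting.** Let $N=2S-1$ be odd ($S\ge 1$) and let $M\ge 1$ be the number of pieces. For $T>0$ and $d=(d_{start},d_{end})\in\mathbb R^{2S\times 3}$ let $p_{d,T}:\mathbb R\to\mathbb R^3$ be the unique polynomial of degree at most $N$ with $(p(0),\dots,p^{(S-1)}(0))=d_{start}$ and $(p(T),\dots,p^{(S-1)}(T))=d_{end}$. An $M$-piece trajectory is given by durations $\mathbf T=(T_1,\dots,T_M)\in(0,\infty)^M$ and boundary data $\mathbf D=(d_1,\dots,d_{M+1})$ with $d_m\in\mathbb R^{S\times 3}$; its $m$-th piece is $p_{\mathbf d_m,T_m}$ with $\mathbf d_m=(d_m,d_{m+1})$. Some entries of $\mathbf D$, collected in $\mathbf D_F$, are fixed; the other, free entries form $\mathbf D_P$. For real weights $\rho$ and $w_i$ and orders $D_{min},D_{max}\in\mathbb N$ put $$J(\mathbf D_P,\mathbf T)=\sum_{m=1}^{M}\int_0^{T_m}\Big(\rho+\sum_{i=D_{min}}^{D_{max}}w_i\big\|p_{\mathbf d_m,T_m}^{(i)}(t)\big\|^2\Big)\,dt .$$ **Algorithm (alternating minimization).** Given $\mathbf D_P^0$,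 let $\mathbf T^0\in\operatorname{argmin}_{\mathbf T\in(0,\infty)^M}J(\mathbf D_P^0,\mathbf T)$ and, for $k=0,1,2,\dots$, $\mathbf D_P^{k+1}\in\operatorname{argmin}_{\mathbf D_P}J(\mathbf D_P,\mathbf T^k)$ and $\mathbf T^{k+1}\in\operatorname{argmin}_{\mathbf T\in(0,\infty)^M}J(\mathbf D_P^{k+1},\mathbf T)$. **Theorem.** Suppose that the iterates $(\mathbf D_P^k,\mathbf T^k)$ converge to a strict local minimum $(\widehat{\mathbf D}_P,\widehat{\mathbf T})$ of $J$, where $\widehat{\mathbf T}\in(0,\infty)^M$, and let $J^*=J(\widehat{\mathbf D}_P,\widehat{\mathbf T})$. Then there are a positive integer $K_c$ and a real $\gamma>0$ such that for all integers $K\ge K_c$ $$J(\mathbf D_P^K,\mathbf T^K)-J^*\le\frac{1}{\gamma(K-K_c)+\big(J(\mathbf D_P^{K_c},\mathbf T^{K_c})-J^*\big)^{-1}},$$ where, if $J(\mathbf D_P^{K_c},\mathbf T^{K_c})=J^*$, the right-hand side is read as $0$ and moreover $J(\mathbf D_P^K,\mathbf T^K)=J^*$ for all $K\ge K_c$. In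 particular $J(\mathbf D_P^K,\mathbf T^K)-J^*=O(1/K)$. -/

import Mathlib

open Filter Topology

noncomputable section

namespace TrajAM

open Polynomial

/-- Index set of the `N + 1 = 2 S` coefficients of a polynomial of odd order `N = 2 S - 1`, and also
of its `2 S` boundary data: `inl` is the start point, `inr` the end point of the piece. -/
abbrev Idx (S : ℕ) : Type := Fin S ⊕ Fin S

/-- The exponent of the basis monomial with index `c`: `0, …, S - 1` and then `S, …, 2 S - 1`. -/
def expo {S : ℕ} : Idx S → ℕ
  | Sum.inl j => (j : ℕ)
  | Sum.inr j => S + (j : ℕ)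

/-- The mapping matrix `A(T)`, which sends the coefficients of a polynomial `p` of order `2 S - 1` to
`(p(0), …, p^{(S-1)}(0), p(T), …, p^{(S-1)}(T))`. It is non-singular for `T ≠ 0`. -/
def mapMat (S : ℕ) (T : ℝ) : Matrix (Idx S) (Idx S) ℝ :=
  Matrix.of fun r c =>
    match r with
    | Sum.inl i => (derivative^[(i : ℕ)] (X ^ expo c : ℝ[X])).eval 0
    | Sum.inr i => (derivative^[(i : ℕ)] (X ^ expo c : ℝ[X])).eval T

/-- Coordinate `a` of the polynomial piece with duration `T` and boundary condition `d`: the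
polynomial with coefficient matrix `A(T)⁻¹ d`. -/
def piecePoly {S : ℕ} (d : Matrix (Idx S) (Fin 3) ℝ) (T : ℝ) (a : Fin 3) : ℝ[X] :=
  ∑ c : Idx S, C (((mapMat S T)⁻¹ * d) c a) * X ^ expo c

/-- Parameters of the planning objective. -/
structure Weights where
  /-- weight of the time regularization -/
  rho : ℝ
  /-- lowest order of derivative that is penalized -/
  Dmin : ℕ
  /-- highest order of derivative that is penalized -/
  Dmax : ℕ
  /-- weight of the derivative of each order -/
  w : ℕ → ℝ

/-- The cost `∫₀ᵀ (ρ + ∑ᵢ wᵢ ‖p⁽ⁱ⁾(t)‖²) dt` of one piece `p`. -/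
def pieceCost {S : ℕ} (W : Weights) (d : Matrix (Idx S) (Fin 3) ℝ) (T : ℝ) : ℝ :=
  ∫ t in (0 : ℝ)..T,
    (W.rho + ∑ i ∈ Finset.Icc W.Dmin W.Dmax,
      W.w i * ∑ a : Fin 3, ((derivative^[i] (piecePoly d T a)).eval t) ^ 2)

/-- The entries of `D = (d₁, …, d_{M+1})`: node, order of derivative, spatial coordinate. -/
abbrev Entry (S M : ℕ) : Type := Fin (M + 1) × Fin S × Fin 3

/-- The boundary data `D` assembled from its fixed part `D_F` and its free part `D_P`; `F` is the set
of free entries. -/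
def assemble {S M : ℕ} (F : Finset (Entry S M)) (DF : {e // e ∉ F} → ℝ) (DP : {e // e ∈ F} → ℝ) :
    Entry S M → ℝ :=
  fun e => if h : e ∈ F then DP ⟨e, h⟩ else DF ⟨e, h⟩

/-- The boundary condition of the `m`-th piece, made of the data at nodes `m` and `m + 1`. -/
def boundary {S M : ℕ} (D : Entry S M → ℝ) (m : Fin M) : Matrix (Idx S) (Fin 3) ℝ :=
  Matrix.of fun r a =>
    match r with
    | Sum.inl i => D (m.castSucc, i, a)
    | Sum.inr i => D (m.succ, i, a)

/-- The objective `J(D_P, T)`: the time integral of `ρ + ∑ᵢ wᵢ ‖P⁽ⁱ⁾‖²` over the whole piecewise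
polynomial trajectory `P`, that is, the sum over the pieces of the integral over each piece. -/
def cost {S M : ℕ} (W : Weights) (F : Finset (Entry S M)) (DF : {e // e ∉ F} → ℝ)
    (DP : {e // e ∈ F} → ℝ) (T : Fin M → ℝ) : ℝ :=
  ∑ m : Fin M, pieceCost W (boundary (assemble F DF DP) m) (T m)

/-- The admissible time allocations: all durations are positive. -/
def posTimes (M : ℕ) : Set (Fin M → ℝ) := {T | ∀ m, 0 < T m}

/-- `T` is a global minimizer of `f` over the positive time allocations. -/
def IsArgminTime {M : ℕ} (f : (Fin M → ℝ) → ℝ) (T : Fin M → ℝ) : Prop :=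
  T ∈ posTimes M ∧ IsMinOn f (posTimes M) T

/-- `(D_P^k, T^k)`, `k = 0, 1, 2, …`, are iterates of alternating minimization of `J`, started at
`D_P^0`. Where a minimizer is not unique, any choice is allowed. -/
structure IsAMRun {ι : Type} {M : ℕ} (J : (ι → ℝ) → (Fin M → ℝ) → ℝ)
    (DP : ℕ → ι → ℝ) (T : ℕ → Fin M → ℝ) : Prop where
  init : IsArgminTime (J (DP 0)) (T 0)
  stepD : ∀ k, IsMinOn (fun D => J D (T k)) Set.univ (DP (k + 1))
  stepT : ∀ k, IsArgminTime (J (DP (k + 1))) (T (k + 1))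

/-- `(D, T)` is a strict local minimum of `J` on the domain of positive time allocations. -/
def IsStrictLocalMin {ι : Type} {M : ℕ} (J : (ι → ℝ) → (Fin M → ℝ) → ℝ)
    (D : ι → ℝ) (T : Fin M → ℝ) : Prop :=
  T ∈ posTimes M ∧ ∀ᶠ y in 𝓝 (D, T), y ≠ (D, T) → J D T < J y.1 y.2

end TrajAM

end

/-!
The heart of the matter is the Łojasiewicz-type estimate `g - g a = o(‖Dg‖)` near `a`, for `g`
rational and regular at `a`. On a formal arc through the zero `a` of a polynomial `f`, the order of
`f` exceeds the order of some partial derivative, because the derivative of an arc lowers its order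
by one. The valuative criterion of integrality turns this into the algebraic fact that
`f ^ n ∈ 𝔪 · (f, ∂₁f, …, ∂ₛf) ^ n` for some `n`, and comparing sizes near `a` gives the estimate.

The objective `J` is rational near the limit, since Cramer's rule expresses the coefficients of each
piece through its duration and boundary data. Both half steps minimize `J` exactly, so moving a
single coordinate of an iterate lowers `J` by no more than the next iteration does, and each partial
derivative is at most the square root of that decrease, up to a constant. With
`δ_K = J(D^K, T^K) - J*` the estimate becomes `δ_K² ≤ C (δ_K - δ_{K+1})`, and so `1/δ_K` grows at
least linearly.
-/

namespace TrajAM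

open Polynomial

section Arcs

universe u

/-- A formal curve through `P` along which `f` does not vanish: a discrete valuation ring with
residue field `k`, and a homomorphism to it that sends `P` into the maximal ideal but not `f`
to `0`. -/
def HasArc (k : Type*) [Field k] {A : Type u} [CommRing A] [Algebra k A] (P : Ideal A) (f : A) :
    Prop :=
  ∃ (V : Type u) (_ : CommRing V) (_ : IsDomain V) (_ : IsDiscreteValuationRing V)
    (_ : Algebra k V) (φ : A →ₐ[k] V),
    Function.Surjective (algebraMap k (IsLocalRing.ResidueField V)) ∧
      P ≤ (IsLocalRing.maximalIdeal V).comap φ ∧ φ f ≠ 0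

variable {k : Type*} [Field k]

theorem HasArc.of_algHom {A B : Type u} [CommRing A] [Algebra k A] [CommRing B] [Algebra k B]
    {P : Ideal A} {Q : Ideal B} {f : A} (ψ : A →ₐ[k] B) (hP : P ≤ Q.comap ψ)
    (h : HasArc k Q (ψ f)) : HasArc k P f := by
  obtain ⟨V, _, _, _, _, φ, hV, hφ, hf⟩ := h
  exact ⟨V, _, ‹_›, ‹_›, _, φ.comp ψ, hV, hP.trans (Ideal.comap_mono hφ), hf⟩

theorem exists_surjective_algHom_polynomial [Infinite k] {σ : Type*} {N : MvPolynomial σ k}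
    (hN : N ≠ 0) {b : σ → k} (hb : MvPolynomial.eval b N = 0) :
    ∃ ψ : MvPolynomial σ k →ₐ[k] k[X], Function.Surjective ψ ∧ ψ N ≠ 0 ∧
      ∀ r, (ψ r).eval 0 = MvPolynomial.eval b r := by
  obtain ⟨c, hc⟩ : ∃ c, MvPolynomial.eval c N ≠ 0 := by
    by_contra! h
    exact hN (MvPolynomial.funext fun x => by simpa using h x)
  let ψ : MvPolynomial σ k →ₐ[k] k[X] := MvPolynomial.aeval fun i => C (b i) + X * C (c i - b i)
  have hψ (t : k) (r) : (ψ r).eval t = MvPolynomial.eval (fun i => b i + t * (c i - b i)) r := by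
    have : (Polynomial.aeval t).comp ψ = MvPolynomial.aeval fun i => b i + t * (c i - b i) := by
      ext i
      simp [ψ]
    exact DFunLike.congr_fun this r
  obtain ⟨i, hi⟩ : ∃ i, c i - b i ≠ 0 := by
    by_contra! h
    exact hc (by rwa [funext fun i => sub_eq_zero.1 (h i)])
  refine ⟨ψ, ?_, fun h => hc ?_, fun r => by simpa using hψ 0 r⟩
  · rw [← AlgHom.range_eq_top, eq_top_iff, ← Polynomial.adjoin_X, Algebra.adjoin_le_iff,
      Set.singleton_subset_iff]
    refine ⟨.C (c i - b i)⁻¹ * (.X i - .C (b i)), ?_⟩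
    change ψ _ = X
    simp only [ψ, map_mul, MvPolynomial.algHom_C, Polynomial.algebraMap_eq, map_sub ψ,
      MvPolynomial.aeval_X, add_sub_cancel_left]
    rw [mul_left_comm, ← C_mul, inv_mul_cancel₀ hi, C_1, mul_one]
  · simpa [h] using (hψ 1 N).symm

theorem exists_finite_injective_algHom_quotient {R S A : Type*} [CommRing R] [CommRing S]
    [CommRing A] [Algebra k R] [Algebra k S] [Algebra k A] {g : R →ₐ[k] A} (hg : g.Finite)
    {ψ : R →ₐ[k] S} (hψ : Function.Surjective ψ) {Q : Ideal A}
    (hQ : Q.comap g = RingHom.ker ψ) :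
    ∃ θ : S →ₐ[k] A ⧸ Q, Function.Injective θ ∧ θ.Finite := by
  let g' := (Ideal.Quotient.mkₐ k Q).comp g
  have hker : RingHom.ker g' = RingHom.ker ψ := by
    rw [← hQ]
    ext r
    exact Ideal.Quotient.eq_zero_iff_mem
  have hle : RingHom.ker ψ.toRingHom ≤ RingHom.ker g'.toRingHom := hker.ge
  refine ⟨ψ.liftOfSurjective hψ g' hle, ?_, ?_⟩
  · rw [injective_iff_map_eq_zero]
    intro s hs
    obtain ⟨r, rfl⟩ := hψ s
    rw [AlgHom.liftOfSurjective_apply] at hs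
    exact hker.le hs
  · refine .of_comp_finite (f := ψ) ?_
    rw [AlgHom.liftOfSurjective_comp]
    exact .comp (.of_surjective _ (Ideal.Quotient.mkₐ_surjective k Q)) hg

variable [IsAlgClosed k]

theorem algebraMap_residueField_surjective {A : Type*} [CommRing A] [Algebra k A]
    [Algebra.FiniteType k A] (P : Ideal A) [P.IsMaximal] :
    Function.Surjective (algebraMap k P.ResidueField) := by
  let := Ideal.Quotient.field P
  have : Module.Finite k (A ⧸ P) := finite_of_finite_type_of_isJacobsonRing k (A ⧸ P)
  rw [IsScalarTower.algebraMap_eq k (A ⧸ P) P.ResidueField]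
  exact P.bijective_algebraMap_quotient_residueField.surjective.comp
    IsAlgClosed.algebraMap_bijective_of_isIntegral.surjective

theorem HasArc.of_isDedekindDomain {A : Type u} [CommRing A] [IsDedekindDomain A] [Algebra k A]
    [Algebra.FiniteType k A] (P : Ideal A) [P.IsMaximal] {f : A} (hf : f ≠ 0) (hfP : f ∈ P) :
    HasArc k P f := by
  have hP : P ≠ ⊥ := ne_of_mem_of_not_mem' hfP hf
  refine ⟨Localization.AtPrime P, inferInstance, inferInstance,
    IsLocalization.AtPrime.isDiscreteValuationRing_of_dedekind_domain A hP _, inferInstance,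
    IsScalarTower.toAlgHom k A _, algebraMap_residueField_surjective P, ?_, ?_⟩
  · exact (Localization.AtPrime.under_maximalIdeal (I := P)).ge
  · simpa using hf

theorem exists_prime_le_finite_polynomial {A : Type*} [CommRing A] [IsDomain A] [Algebra k A]
    [Algebra.FiniteType k A] (P : Ideal A) [P.IsMaximal] {f : A} (hf : f ≠ 0) (hfP : f ∈ P) :
    ∃ Q ≤ P, Q.IsPrime ∧ f ∉ Q ∧
      ∃ θ : k[X] →ₐ[k] A ⧸ Q, Function.Injective θ ∧ θ.Finite := by
  obtain ⟨s, g, hg, hgfin⟩ := exists_finite_inj_algHom_of_fg k A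
  algebraize [g.toRingHom]
  have : Module.Finite (MvPolynomial (Fin s) k) A := hgfin
  have : FaithfulSMul (MvPolynomial (Fin s) k) A := (faithfulSMul_iff_algebraMap_injective _ _).2 hg
  obtain ⟨b, hb⟩ : ∃ b : Fin s → k,
      P.under (MvPolynomial (Fin s) k) = MvPolynomial.vanishingIdeal k {b} :=
    MvPolynomial.isMaximal_iff_eq_vanishingIdeal_singleton.1
      (Ideal.isMaximal_comap_of_isIntegral_of_isMaximal P)
  obtain ⟨N, hfN, hN⟩ := Submodule.exists_mem_ne_zero_of_ne_bot <|
    Ideal.comap_ne_bot_of_integral_mem (R := MvPolynomial (Fin s) k) hf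
      (Ideal.mem_span_singleton_self f) (Algebra.IsIntegral.isIntegral f)
  replace hfN : f ∣ g N := Ideal.mem_span_singleton.1 hfN
  have hmem (r) : g r ∈ P ↔ MvPolynomial.eval b r = 0 :=
    (SetLike.ext_iff.1 hb r).trans (by simp)
  obtain ⟨ψ, hψ, hψN, hψb⟩ :=
    exists_surjective_algHom_polynomial hN ((hmem N).1 (P.mem_of_dvd hfN hfP))
  have hle : RingHom.ker ψ ≤ P.under (MvPolynomial (Fin s) k) := fun r hr =>
    (hmem r).2 (by rw [← hψb, (RingHom.mem_ker.1 hr : ψ r = 0), eval_zero])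
  have : (RingHom.ker ψ).IsPrime := RingHom.ker_isPrime ψ
  obtain ⟨Q, hQP, hQ, hQψ⟩ := Ideal.exists_ideal_le_liesOver_of_le P hle
  have hQψ : Q.comap g = RingHom.ker ψ := hQψ.over.symm
  refine ⟨Q, hQP, hQ, fun hfQ => hψN ?_, exists_finite_injective_algHom_quotient hgfin hψ hQψ⟩
  exact hQψ.le (Q.mem_of_dvd hfN hfQ : N ∈ Q.comap g)

variable [CharZero k]

theorem HasArc.of_finite_polynomial {A : Type u} [CommRing A] [IsDomain A] [Algebra k A]
    {θ : k[X] →ₐ[k] A} (hθ : Function.Injective θ) (hfin : θ.Finite) (P : Ideal A) [P.IsMaximal]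
    {f : A} (hf : f ≠ 0) (hfP : f ∈ P) : HasArc k P f := by
  algebraize [θ.toRingHom]
  have : FaithfulSMul k[X] A := (faithfulSMul_iff_algebraMap_injective _ _).2 hθ
  have : IsScalarTower k k[X] A := .of_algebraMap_eq fun x => (θ.commutes x).symm
  have : Module.Finite k[X] A := hfin
  let L := FractionRing A
  let := FractionRing.liftAlgebra k[X] L
  have : FiniteDimensional (FractionRing k[X]) L := .of_isLocalization k[X] A (nonZeroDivisors k[X])
  let C := integralClosure k[X] L
  have : Module.Finite k[X] C := IsIntegralClosure.finite k[X] (FractionRing k[X]) L C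
  have : Algebra.FiniteType k C := .trans (S := k[X]) inferInstance inferInstance
  let ψ : A →ₐ[k[X]] C := IsIntegralClosure.lift k[X] C L
  have hψ : Function.Injective ψ := by
    refine .of_comp (f := algebraMap C L) ?_
    have : algebraMap C L ∘ ψ = algebraMap A L :=
      funext (IsIntegralClosure.algebraMap_lift k[X] C L)
    exact this ▸ IsFractionRing.injective A L
  algebraize [ψ.toRingHom]
  have : IsScalarTower k[X] A C := .of_algebraMap_eq fun x => (ψ.commutes x).symm
  have : Algebra.IsIntegral A C := .tower_top k[X]
  obtain ⟨Q, hQ, hQP⟩ := Ideal.exists_ideal_over_maximal_of_isIntegral (S := C) P <| by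
    rw [(RingHom.injective_iff_ker_eq_bot (algebraMap A C)).1 hψ]
    exact bot_le
  exact .of_algHom (ψ.restrictScalars k) hQP.ge <|
    .of_isDedekindDomain Q ((map_ne_zero_iff ψ hψ).2 hf) (hQP.ge hfP)

theorem HasArc.of_finiteType {A : Type u} [CommRing A] [IsDomain A] [Algebra k A]
    [Algebra.FiniteType k A] (P : Ideal A) [P.IsMaximal] {f : A} (hf : f ≠ 0) (hfP : f ∈ P) :
    HasArc k P f := by
  obtain ⟨Q, hQP, _, hfQ, θ, hθ, hfin⟩ := exists_prime_le_finite_polynomial (k := k) P hf hfP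
  have : (P.map (Ideal.Quotient.mk Q)).IsMaximal :=
    Ideal.IsMaximal.map_of_surjective_of_ker_le Ideal.Quotient.mk_surjective (by rwa [Ideal.mk_ker])
  exact .of_algHom (Ideal.Quotient.mkₐ k Q) (Q := P.map (Ideal.Quotient.mk Q))
    Ideal.le_comap_map <| .of_finite_polynomial hθ hfin _ (mt Ideal.Quotient.eq_zero_iff_mem.1 hfQ)
      (Ideal.mem_map_of_mem _ hfP)

end Arcs

section Curves

theorem derivative_aeval {σ k : Type*} [Fintype σ] [CommRing k] (p : σ → k[X])
    (f : MvPolynomial σ k) :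
    derivative (MvPolynomial.aeval p f) =
      ∑ i, MvPolynomial.aeval p (MvPolynomial.pderiv i f) * derivative (p i) := by
  classical
  induction f using MvPolynomial.induction_on with
  | C a => simp
  | add f g hf hg => simp [hf, hg, add_mul, Finset.sum_add_distrib]
  | mul_X f j hf =>
    have hprod (i) : MvPolynomial.aeval p (MvPolynomial.pderiv i (f * .X j)) * derivative (p i) =
        MvPolynomial.aeval p (MvPolynomial.pderiv i f) * derivative (p i) * p j +
          if j = i then MvPolynomial.aeval p f * derivative (p j) else 0 := by
      rw [MvPolynomial.pderiv_mul, MvPolynomial.pderiv_X, Pi.single_apply]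
      split_ifs with hij
      · subst hij
        simp only [map_add, map_mul, MvPolynomial.aeval_X, map_one]
        ring
      · simp only [map_add, map_mul, MvPolynomial.aeval_X, map_zero]
        ring
    simp_rw [hprod, Finset.sum_add_distrib, ← Finset.sum_mul, ← hf]
    simp [derivative_mul]

theorem dvd_aeval_sub_aeval {σ R A : Type*} [CommRing R] [CommRing A] [Algebra R A] {d : A}
    {x y : σ → A} (h : ∀ i, d ∣ x i - y i) (f : MvPolynomial σ R) :
    d ∣ MvPolynomial.aeval x f - MvPolynomial.aeval y f := by
  simp only [← Ideal.mem_span_singleton, ← Ideal.Quotient.mk_eq_mk_iff_sub_mem,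
    ← Ideal.Quotient.mkₐ_eq_mk R, MvPolynomial.comp_aeval_apply] at h ⊢
  simp only [h]

theorem X_pow_succ_dvd_of_dvd_derivative {k : Type*} [Field k] [CharZero k] {F : k[X]} {n : ℕ}
    (h0 : F.coeff 0 = 0) (h : X ^ n ∣ derivative F) : X ^ (n + 1) ∣ F := by
  rw [X_pow_dvd_iff] at h ⊢
  rintro (_ | m) hm
  · exact h0
  · have hcoeff := h m (by lia)
    rw [coeff_derivative] at hcoeff
    exact (mul_eq_zero.1 hcoeff).resolve_right m.cast_add_one_ne_zero

variable {k V : Type*} [Field k] [CommRing V] [IsDomain V] [Algebra k V] {π : V}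

theorem X_pow_dvd_iff_pow_dvd_aeval (hπ : Irreducible π) {n : ℕ} {p : k[X]} :
    X ^ n ∣ p ↔ π ^ n ∣ aeval π p := by
  refine ⟨fun h => by simpa using map_dvd (aeval π) h, fun h => ?_⟩
  induction n generalizing p with
  | zero => simp
  | succ n ih =>
    have hX : X ∣ p := by
      rw [X_dvd_iff]
      by_contra h0
      have hdvd : π ∣ aeval π p := (dvd_pow_self π n.succ_ne_zero).trans h
      rw [← divX_mul_X_add p, map_add, map_mul, aeval_X, aeval_C,
        dvd_add_right (dvd_mul_left _ _)] at hdvd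
      exact hπ.not_isUnit (isUnit_of_dvd_unit hdvd ((IsUnit.mk0 _ h0).map (algebraMap k V)))
    obtain ⟨q, rfl⟩ := hX
    rw [map_mul, aeval_X, pow_succ', mul_dvd_mul_iff_left hπ.ne_zero] at h
    exact pow_succ' (X : k[X]) n ▸ mul_dvd_mul_left X (ih h)

theorem pow_dvd_aeval_iff_X_pow_dvd {σ : Type*} (hπ : Irreducible π) {x : σ → V} {p : σ → k[X]}
    {m n : ℕ} (hmn : m ≤ n) (hp : ∀ i, π ^ n ∣ x i - aeval π (p i)) (g : MvPolynomial σ k) :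
    π ^ m ∣ MvPolynomial.aeval x g ↔ X ^ m ∣ MvPolynomial.aeval p g := by
  have hcongr := (pow_dvd_pow π hmn).trans (dvd_aeval_sub_aeval hp g)
  rw [X_pow_dvd_iff_pow_dvd_aeval hπ, MvPolynomial.comp_aeval_apply]
  exact dvd_iff_dvd_of_dvd_sub hcongr

variable [IsDiscreteValuationRing V]

theorem exists_pow_dvd_sub_aeval (hπ : Irreducible π)
    (hV : Function.Surjective (algebraMap k (IsLocalRing.ResidueField V))) (n : ℕ) (v : V) :
    ∃ p : k[X], π ^ n ∣ v - aeval π p := by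
  induction n generalizing v with
  | zero => exact ⟨0, by simp⟩
  | succ n ih =>
    obtain ⟨c, hc⟩ := hV (IsLocalRing.residue V v)
    obtain ⟨w, hw⟩ : π ∣ v - algebraMap k V c := by
      rw [← Ideal.mem_span_singleton, ← hπ.maximalIdeal_eq]
      exact Ideal.Quotient.eq.1 hc.symm
    obtain ⟨p, z, hz⟩ := ih w
    refine ⟨C c + X * p, z, ?_⟩
    rw [map_add, map_mul, aeval_C, aeval_X, ← sub_sub, hw, ← mul_sub, hz, pow_succ', mul_assoc]

variable [CharZero k] {σ : Type*} [Finite σ] {f : MvPolynomial σ k} {x : σ → V}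

theorem pow_succ_dvd_aeval (hπ : Irreducible π)
    (hV : Function.Surjective (algebraMap k (IsLocalRing.ResidueField V)))
    (hf : π ∣ MvPolynomial.aeval x f) {n : ℕ}
    (hder : ∀ i, π ^ n ∣ MvPolynomial.aeval x (MvPolynomial.pderiv i f)) :
    π ^ (n + 1) ∣ MvPolynomial.aeval x f := by
  have := Fintype.ofFinite σ
  choose p hp using fun i => exists_pow_dvd_sub_aeval hπ hV (n + 1) (x i)
  rw [pow_dvd_aeval_iff_X_pow_dvd hπ le_rfl hp]
  apply X_pow_succ_dvd_of_dvd_derivative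
  · rw [← X_dvd_iff, ← pow_one X, ← pow_dvd_aeval_iff_X_pow_dvd hπ (by lia) hp, pow_one]
    exact hf
  · rw [derivative_aeval]
    exact Finset.dvd_sum fun i _ =>
      ((pow_dvd_aeval_iff_X_pow_dvd hπ n.le_succ hp _).1 (hder i)).mul_right _

theorem exists_not_dvd_aeval_pderiv
    (hV : Function.Surjective (algebraMap k (IsLocalRing.ResidueField V)))
    (hf0 : MvPolynomial.aeval x f ≠ 0)
    (hf : MvPolynomial.aeval x f ∈ IsLocalRing.maximalIdeal V) :
    ∃ i, ¬ MvPolynomial.aeval x f ∣ MvPolynomial.aeval x (MvPolynomial.pderiv i f) := by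
  by_contra! hdvd
  obtain ⟨π, hπ⟩ := IsDiscreteValuationRing.exists_irreducible V
  obtain ⟨n, hn⟩ := IsDiscreteValuationRing.associated_pow_irreducible hf0 hπ
  rw [hπ.maximalIdeal_eq, Ideal.mem_span_singleton] at hf
  have hsucc : π ^ (n + 1) ∣ π ^ n :=
    (pow_succ_dvd_aeval hπ hV hf fun i => hn.symm.dvd.trans (hdvd i)).trans hn.dvd
  exact n.lt_irrefl ((pow_dvd_pow_iff hπ.ne_zero hπ.not_isUnit).1 hsucc)

end Curves

section Integrality

section Adjoin

variable {R K ι : Type*} [CommRing R] [Field K] [Algebra R K] {f : R} {I J : Ideal R}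

theorem exists_mem_mul_pow_add (hfI : f ∈ I) {y z : K}
    (hy : ∃ n, ∃ h ∈ J * I ^ n, algebraMap R K f ^ n * y = algebraMap R K h)
    (hz : ∃ n, ∃ h ∈ J * I ^ n, algebraMap R K f ^ n * z = algebraMap R K h) :
    ∃ n, ∃ h ∈ J * I ^ n, algebraMap R K f ^ n * (y + z) = algebraMap R K h := by
  obtain ⟨m, g, hg, hgy⟩ := hy
  obtain ⟨n, h, hh, hhz⟩ := hz
  refine ⟨m + n, g * f ^ n + h * f ^ m, add_mem ?_ ?_, ?_⟩
  · rw [pow_add, ← mul_assoc]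
    exact Ideal.mul_mem_mul hg (Ideal.pow_mem_pow hfI n)
  · rw [add_comm, pow_add, ← mul_assoc]
    exact Ideal.mul_mem_mul hh (Ideal.pow_mem_pow hfI m)
  · simp only [map_add, map_mul, map_pow, ← hgy, ← hhz]
    ring

variable {d : ι → R}

theorem exists_mem_pow_of_mem_adjoin (hf : algebraMap R K f ≠ 0) (hfI : f ∈ I)
    (hdI : ∀ i, d i ∈ I) {y : K}
    (hy : y ∈ Algebra.adjoin R (Set.range fun i => algebraMap R K (d i) / algebraMap R K f)) :
    ∃ n, ∃ h ∈ I ^ n, algebraMap R K f ^ n * y = algebraMap R K h := by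
  induction hy using Algebra.adjoin_induction with
  | mem y hy =>
    obtain ⟨i, rfl⟩ := hy
    exact ⟨1, d i, by simpa using hdI i, by field_simp⟩
  | algebraMap r => exact ⟨0, r, by simp, by simp⟩
  | add y z _ _ hy hz => simpa using exists_mem_mul_pow_add (J := ⊤) hfI (by simpa) (by simpa)
  | mul y z _ _ hy hz =>
    obtain ⟨m, g, hg, hgy⟩ := hy
    obtain ⟨n, h, hh, hhz⟩ := hz
    refine ⟨m + n, g * h, pow_add I m n ▸ Ideal.mul_mem_mul hg hh, ?_⟩
    rw [map_mul, ← hgy, ← hhz, pow_add, mul_mul_mul_comm]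

theorem exists_pow_mem_of_map_adjoin_eq_top [FaithfulSMul R K] (hf : f ≠ 0) (hfI : f ∈ I)
    (hdI : ∀ i, d i ∈ I)
    (hJ : J.map (algebraMap R (Algebra.adjoin R
      (Set.range fun i => algebraMap R K (d i) / algebraMap R K f))) = ⊤) :
    ∃ n, f ^ n ∈ J * I ^ n := by
  have hinj := FaithfulSMul.algebraMap_injective R K
  have hf' : algebraMap R K f ≠ 0 := (map_ne_zero_iff _ hinj).2 hf
  set A := Algebra.adjoin R (Set.range fun i => algebraMap R K (d i) / algebraMap R K f)
  have hmem (y : A) (hy : y ∈ J • (⊤ : Submodule R A)) :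
      ∃ n, ∃ h ∈ J * I ^ n, algebraMap R K f ^ n * (y : K) = algebraMap R K h := by
    induction hy using Submodule.smul_induction_on' with
    | smul r hr y _ =>
      obtain ⟨n, h, hh, hhy⟩ := exists_mem_pow_of_mem_adjoin hf' hfI hdI y.2
      refine ⟨n, r * h, Ideal.mul_mem_mul hr hh, ?_⟩
      rw [map_mul, ← hhy, Subalgebra.coe_smul, Algebra.smul_def, mul_left_comm]
    | add y _ z _ hy hz => exact exists_mem_mul_pow_add hfI hy hz
  obtain ⟨n, h, hh, hh1⟩ := hmem 1 (by simp [Ideal.smul_top_eq_map, hJ])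
  rw [OneMemClass.coe_one, mul_one, ← map_pow] at hh1
  exact ⟨n, hinj hh1 ▸ hh⟩

end Adjoin

variable {σ k : Type*} [Finite σ] [Field k] [CharZero k] [IsAlgClosed k]

/-- The Tjurina ideal of `f`, generated by `f` and its partial derivatives; it measures how singular
the zero set of `f` is. -/
noncomputable def tjurinaIdeal {σ k : Type*} [CommRing k] (f : MvPolynomial σ k) :
    Ideal (MvPolynomial σ k) :=
  Ideal.span (insert f (Set.range fun i => MvPolynomial.pderiv i f))

theorem exists_pow_mem_ker_eval_mul_tjurinaIdeal_pow {f : MvPolynomial σ k} {a : σ → k}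
    (hfa : MvPolynomial.eval a f = 0) :
    ∃ n, f ^ n ∈ RingHom.ker (MvPolynomial.eval a) * tjurinaIdeal f ^ n := by
  obtain rfl | hf := eq_or_ne f 0
  · exact ⟨1, by simp⟩
  let R := MvPolynomial σ k
  let K := FractionRing R
  let d (i : σ) : K := algebraMap R K (MvPolynomial.pderiv i f) / algebraMap R K f
  let A := Algebra.adjoin R (Set.range d)
  have hfK : algebraMap R K f ≠ 0 := by simpa using hf
  suffices htop : (RingHom.ker (MvPolynomial.eval a)).map (algebraMap R A) = ⊤ from
    exists_pow_mem_of_map_adjoin_eq_top hf (Ideal.subset_span (Set.mem_insert _ _))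
      (fun i => Ideal.subset_span (Set.mem_insert_of_mem _ ⟨i, rfl⟩)) htop
  -- Otherwise there is an arc along which `f` tends to `0` but divides all its partial derivatives.
  by_contra htop
  obtain ⟨P, hP, hle⟩ := Ideal.exists_le_maximal _ htop
  have : Algebra.FiniteType R A :=
    (Subalgebra.fg_iff_finiteType _).1 (Subalgebra.fg_def.2 ⟨_, Set.finite_range d, rfl⟩)
  have : Algebra.FiniteType k A := .trans (S := R) inferInstance inferInstance
  have hfA : algebraMap R A f ≠ 0 := fun h => hfK (congrArg Subtype.val h)
  have hfP : algebraMap R A f ∈ P := hle (Ideal.mem_map_of_mem _ hfa)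
  obtain ⟨V, _, _, _, _, φ, hV, hφ, hφf⟩ := HasArc.of_finiteType (k := k) P hfA hfP
  let χ : R →ₐ[k] V := φ.comp (IsScalarTower.toAlgHom k R A)
  have hχ (r) : MvPolynomial.aeval (fun i => χ (.X i)) r = φ (algebraMap R A r) :=
    (DFunLike.congr_fun (MvPolynomial.aeval_unique χ) r).symm
  obtain ⟨i, hi⟩ := exists_not_dvd_aeval_pderiv (f := f) hV (by rwa [hχ])
    (by rw [hχ]; exact hφ hfP)
  rw [hχ, hχ] at hi
  refine hi (map_dvd φ ⟨⟨d i, Algebra.subset_adjoin ⟨i, rfl⟩⟩, Subtype.ext ?_⟩)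
  exact (mul_div_cancel₀ _ hfK).symm

end Integrality

section GradientInequality

open Asymptotics

section IdealBounds

variable {R α 𝕜 : Type*} [CommRing R] [NormedField 𝕜] {l : Filter α} {ev : α → R →+* 𝕜}
  {I J : Ideal R} {φ : α → ℝ} {r : R}

theorem isBigO_of_mem_span (hbd : ∀ r, (fun x => ev x r) =O[l] fun _ => (1 : ℝ)) {s : Set R}
    (hs : ∀ r ∈ s, (fun x => ev x r) =O[l] φ) (hr : r ∈ Ideal.span s) :
    (fun x => ev x r) =O[l] φ := by
  induction hr using Submodule.span_induction with
  | mem r hr => exact hs r hr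
  | zero => simpa using isBigO_zero φ l
  | add r s _ _ hr hs => simpa using hr.add hs
  | smul c r _ hr => simpa using (hbd c).mul hr

theorem isBigO_pow_of_mem_pow (hbd : ∀ r, (fun x => ev x r) =O[l] fun _ => (1 : ℝ))
    (hI : ∀ r ∈ I, (fun x => ev x r) =O[l] φ) {n : ℕ} (hr : r ∈ I ^ n) :
    (fun x => ev x r) =O[l] fun x => φ x ^ n := by
  induction n generalizing r with
  | zero => simpa using hbd r
  | succ n ih =>
    rw [pow_succ] at hr
    induction hr using Submodule.mul_induction_on' with
    | mem_mul_mem r hr s hs => simpa [pow_succ] using (ih hr).mul (hI s hs)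
    | add r _ s _ hr hs => simpa using hr.add hs

theorem isLittleO_of_mem_mul (hJ : ∀ r ∈ J, (fun x => ev x r) =o[l] fun _ => (1 : ℝ))
    (hI : ∀ r ∈ I, (fun x => ev x r) =O[l] φ) (hr : r ∈ J * I) : (fun x => ev x r) =o[l] φ := by
  induction hr using Submodule.mul_induction_on' with
  | mem_mul_mem r hr s hs => simpa using (hJ r hr).mul_isBigO (hI s hs)
  | add r _ s _ hr hs => simpa using hr.add hs

end IdealBounds

section PolynomialDerivative

variable {σ 𝕜 : Type*} [Finite σ] [NontriviallyNormedField 𝕜]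

theorem differentiable_eval (p : MvPolynomial σ 𝕜) :
    Differentiable 𝕜 fun x => MvPolynomial.eval x p := by
  have := Fintype.ofFinite σ
  induction p using MvPolynomial.induction_on with
  | C c => simp
  | add p q hp hq => simpa using hp.fun_add hq
  | mul_X p i hp => simpa using hp.fun_mul (differentiable_apply i)

theorem fderiv_eval_single [DecidableEq σ] (p : MvPolynomial σ 𝕜) (x : σ → 𝕜) (i : σ) :
    fderiv 𝕜 (fun x => MvPolynomial.eval x p) x (Pi.single i 1) =
      MvPolynomial.eval x (MvPolynomial.pderiv i p) := by
  have := Fintype.ofFinite σ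
  induction p using MvPolynomial.induction_on with
  | C c => simp
  | add p q hp hq =>
    simp only [map_add]
    rw [fderiv_fun_add (differentiable_eval p x) (differentiable_eval q x)]
    simp [hp, hq]
  | mul_X p j hp =>
    simp only [map_mul, MvPolynomial.eval_X, MvPolynomial.pderiv_mul, map_add]
    rw [fderiv_fun_mul (differentiable_eval p x) (by fun_prop)]
    rcases eq_or_ne j i with rfl | hji
    · simp [hp, fderiv_apply, add_comm, mul_comm]
    · simp [hp, fderiv_apply, hji, mul_comm]

end PolynomialDerivative

variable {σ : Type*} [Fintype σ]

theorem eval_isLittleO_sum_norm_pderiv {𝕜 : Type*} [NormedField 𝕜] [CharZero 𝕜] [IsAlgClosed 𝕜]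
    {f : MvPolynomial σ 𝕜} {a : σ → 𝕜} (hfa : MvPolynomial.eval a f = 0) :
    (fun x => MvPolynomial.eval x f) =o[𝓝 a]
      fun x => ∑ i, ‖MvPolynomial.eval x (MvPolynomial.pderiv i f)‖ := by
  let φ (x : σ → 𝕜) := ‖MvPolynomial.eval x f‖ +
    ∑ i, ‖MvPolynomial.eval x (MvPolynomial.pderiv i f)‖
  have hbd (r : MvPolynomial σ 𝕜) : (fun x => MvPolynomial.eval x r) =O[𝓝 a] fun _ => (1 : ℝ) :=
    (MvPolynomial.continuous_eval r).continuousAt.isBigO_one ℝ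
  have hmem (r) (hr : r ∈ tjurinaIdeal f) : (fun x => MvPolynomial.eval x r) =O[𝓝 a] φ := by
    refine isBigO_of_mem_span hbd ?_ hr
    rintro _ (rfl | ⟨i, rfl⟩) <;>
      refine isBigO_of_le _ fun x => (le_trans ?_ (le_abs_self (φ x)))
    · exact le_add_of_nonneg_right (by positivity)
    · exact le_add_of_nonneg_of_le (norm_nonneg _) <| Finset.single_le_sum
        (f := fun i => ‖MvPolynomial.eval x (MvPolynomial.pderiv i f)‖)
        (fun _ _ => norm_nonneg _) (Finset.mem_univ i)
  have hker (r) (hr : r ∈ RingHom.ker (MvPolynomial.eval a)) :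
      (fun x => MvPolynomial.eval x r) =o[𝓝 a] fun _ => (1 : ℝ) :=
    (isLittleO_one_iff ℝ).2 <| (RingHom.mem_ker.1 hr) ▸
      (MvPolynomial.continuous_eval r).tendsto a
  obtain ⟨n, hn⟩ := exists_pow_mem_ker_eval_mul_tjurinaIdeal_pow hfa
  have hn0 : n ≠ 0 := by
    rintro rfl
    simp at hn
  have hpow : (fun x => MvPolynomial.eval x (f ^ n)) =o[𝓝 a] fun x => φ x ^ n :=
    isLittleO_of_mem_mul hker (fun r hr => isBigO_pow_of_mem_pow hbd hmem hr) hn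
  have hφ : (fun x => MvPolynomial.eval x f) =o[𝓝 a] φ := by
    simp only [map_pow] at hpow
    exact hpow.of_pow hn0
  exact hφ.trans_isBigO (by simpa [φ] using hφ.norm_left.right_isBigO_sub)

theorem eval_isLittleO_fderiv {f : MvPolynomial σ ℝ} {a : σ → ℝ}
    (hfa : MvPolynomial.eval a f = 0) :
    (fun x => MvPolynomial.eval x f) =o[𝓝 a] fderiv ℝ fun x => MvPolynomial.eval x f := by
  classical
  let c (x : σ → ℝ) (i : σ) : ℂ := x i
  have hc : Continuous c := by fun_prop
  have hmap (g : MvPolynomial σ ℝ) (x : σ → ℝ) :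
      MvPolynomial.eval (c x) (MvPolynomial.map Complex.ofRealHom g) = MvPolynomial.eval x g :=
    (MvPolynomial.eval_map _ _ _).trans (MvPolynomial.eval₂_comp Complex.ofRealHom x g).symm
  have hcomplex := (eval_isLittleO_sum_norm_pderiv (a := c a)
    (f := MvPolynomial.map Complex.ofRealHom f) (by simp [hmap, hfa])).comp_tendsto (hc.tendsto a)
  simp only [Function.comp_def, MvPolynomial.pderiv_map, hmap] at hcomplex
  have hbound (i : σ) : (fun x => ‖((MvPolynomial.eval x (MvPolynomial.pderiv i f) : ℝ) : ℂ)‖)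
      =O[𝓝 a] fderiv ℝ fun x => MvPolynomial.eval x f := by
    refine .of_bound ‖(Pi.single i 1 : σ → ℝ)‖ (.of_forall fun x => ?_)
    rw [norm_norm, Complex.norm_real, ← fderiv_eval_single, mul_comm]
    exact ContinuousLinearMap.le_opNorm _ _
  refine (isLittleO_norm_left.1 ?_).trans_isBigO
    (IsBigO.fun_sum fun i (_ : i ∈ Finset.univ) => hbound i)
  simpa only [← Complex.norm_real] using hcomplex.norm_left

end GradientInequality

section RationalGerms

variable {σ : Type*}

/-- The functions that agree near `a` with a rational function which is regular at `a`. Clearing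
denominators keeps division out of the definition. -/
def rationalAt (a : σ → ℝ) : Subalgebra ℝ ((σ → ℝ) → ℝ) where
  carrier := {g | ∃ p q : MvPolynomial σ ℝ, MvPolynomial.eval a q ≠ 0 ∧
    ∀ᶠ x in 𝓝 a, MvPolynomial.eval x q * g x = MvPolynomial.eval x p}
  mul_mem' := by
    rintro g h ⟨p, q, hq, hg⟩ ⟨p', q', hq', hh⟩
    refine ⟨p * p', q * q', by simp [hq, hq'], ?_⟩
    filter_upwards [hg, hh] with x hg hh
    simp only [map_mul, Pi.mul_apply, ← hg, ← hh]
    ring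
  add_mem' := by
    rintro g h ⟨p, q, hq, hg⟩ ⟨p', q', hq', hh⟩
    refine ⟨p * q' + p' * q, q * q', by simp [hq, hq'], ?_⟩
    filter_upwards [hg, hh] with x hg hh
    simp only [map_mul, map_add, Pi.add_apply, ← hg, ← hh]
    ring
  algebraMap_mem' c := ⟨MvPolynomial.C c, 1, by simp, by simp⟩

variable {a : σ → ℝ} {g : (σ → ℝ) → ℝ}

theorem coord_mem_rationalAt (i : σ) : (fun x => x i) ∈ rationalAt a :=
  ⟨MvPolynomial.X i, 1, by simp, by simp⟩

theorem eventually_eq_div_of_mem_rationalAt (hg : g ∈ rationalAt a) :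
    ∃ p q : MvPolynomial σ ℝ, MvPolynomial.eval a q ≠ 0 ∧
      ∀ᶠ x in 𝓝 a, MvPolynomial.eval x q ≠ 0 ∧
        g x = MvPolynomial.eval x p / MvPolynomial.eval x q := by
  obtain ⟨p, q, hq, h⟩ := hg
  refine ⟨p, q, hq, ?_⟩
  filter_upwards [h, (MvPolynomial.continuous_eval q).continuousAt.eventually_ne hq] with x h hqx
  exact ⟨hqx, (eq_div_of_mul_eq hqx ((mul_comm _ _).trans h))⟩

theorem inv_mem_rationalAt (hg : g ∈ rationalAt a) (ha : g a ≠ 0) : g⁻¹ ∈ rationalAt a := by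
  obtain ⟨p, q, _, h⟩ := eventually_eq_div_of_mem_rationalAt hg
  have hp : MvPolynomial.eval a p ≠ 0 := by
    rintro hp
    exact ha (by rw [h.self_of_nhds.2, hp, zero_div])
  refine ⟨q, p, hp, ?_⟩
  filter_upwards [h, (MvPolynomial.continuous_eval p).continuousAt.eventually_ne hp]
    with x ⟨_, hx⟩ hpx
  rw [Pi.inv_apply, hx, inv_div, mul_div_cancel₀ _ hpx]

end RationalGerms

section RationalGradient

open Asymptotics

variable {σ : Type*} [Fintype σ] {a : σ → ℝ} {g : (σ → ℝ) → ℝ}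

theorem analyticAt_of_mem_rationalAt (hg : g ∈ rationalAt a) : AnalyticAt ℝ g a := by
  obtain ⟨p, q, hq, h⟩ := eventually_eq_div_of_mem_rationalAt hg
  exact ((AnalyticOnNhd.eval_mvPolynomial p a (Set.mem_univ a)).fun_div
    (AnalyticOnNhd.eval_mvPolynomial q a (Set.mem_univ a)) hq).congr
    (h.mono fun x hx => hx.2.symm)

theorem sub_isLittleO_fderiv_of_mem_rationalAt (hg : g ∈ rationalAt a) :
    (fun x => g x - g a) =o[𝓝 a] fderiv ℝ g := by
  have hdiff : ∀ᶠ x in 𝓝 a, DifferentiableAt ℝ g x :=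
    (analyticAt_of_mem_rationalAt hg).eventually_analyticAt.mono fun _ hx => hx.differentiableAt
  obtain ⟨p, q, hq, h⟩ := hg
  have hqa : ContinuousAt (fun x => MvPolynomial.eval x q) a :=
    (MvPolynomial.continuous_eval q).continuousAt
  let f (x : σ → ℝ) := MvPolynomial.eval x (p - MvPolynomial.C (g a) * q)
  have hf : f =ᶠ[𝓝 a] fun x => MvPolynomial.eval x q * (g x - g a) := by
    filter_upwards [h] with x hx
    simp only [f, map_sub, map_mul, MvPolynomial.eval_C, ← hx]
    ring
  have hfD : f =o[𝓝 a] fderiv ℝ f := eval_isLittleO_fderiv (by simpa [f] using hf.self_of_nhds)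
  have hgf : (fun x => g x - g a) =O[𝓝 a] f := by
    have hinv := ((hqa.inv₀ hq).isBigO_one ℝ).mul (isBigO_refl f (𝓝 a))
    refine hinv.congr' ?_ (by simp)
    filter_upwards [hf, hqa.eventually_ne hq] with x hx hqx
    rw [hx, Pi.inv_apply, inv_mul_cancel_left₀ hqx]
  have hDf : fderiv ℝ f =ᶠ[𝓝 a] fun x => MvPolynomial.eval x q • fderiv ℝ g x +
      (g x - g a) • fderiv ℝ (fun x => MvPolynomial.eval x q) x := by
    filter_upwards [hf.fderiv (𝕜 := ℝ), hdiff] with x hx hgx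
    rw [hx, fderiv_fun_mul (differentiable_eval q x) (hgx.sub_const _), fderiv_sub_const]
  have hDq : ContinuousAt (fderiv ℝ fun x => MvPolynomial.eval x q) a :=
    (AnalyticOnNhd.eval_mvPolynomial q a (Set.mem_univ a)).fderiv.continuousAt
  have hrem : (fun x => (g x - g a) • fderiv ℝ (fun x => MvPolynomial.eval x q) x) =o[𝓝 a]
      fderiv ℝ f := by
    simpa using ((hgf.trans_isLittleO hfD).norm_right.smul_isBigO (hDq.isBigO_one ℝ)).norm_right
  have hDfDg : fderiv ℝ f =O[𝓝 a] fderiv ℝ g := by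
    refine hrem.right_isBigO_sub.trans ?_
    have hqDg := (hqa.isBigO_one ℝ).smul (isBigO_refl (fderiv ℝ g) (𝓝 a)).norm_right
    refine (hqDg.congr' ?_ (by simp)).of_norm_right
    filter_upwards [hDf] with x hx
    rw [hx, add_sub_cancel_right]
  exact (hgf.trans_isLittleO hfD).trans_isBigO hDfDg

end RationalGradient

section Descent

variable {E F : Type*} [NormedAddCommGroup E] [NormedSpace ℝ E] [NormedAddCommGroup F]
  [NormedSpace ℝ F]

theorem exists_norm_sub_sub_fderiv_le {f : E → F} {a : E} (hf : ContDiffAt ℝ 2 f a) :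
    ∃ L > 0, ∃ ε > 0, ∀ x ∈ Metric.ball a ε, ∀ y ∈ Metric.ball a ε,
      ‖f y - f x - fderiv ℝ f x (y - x)‖ ≤ L * ‖y - x‖ ^ 2 := by
  obtain ⟨K, t, ht, hlip⟩ :=
    (hf.fderiv_right (m := 1) one_add_one_eq_two.le).exists_lipschitzOnWith
  have hdiff : ∀ᶠ x in 𝓝 a, DifferentiableAt ℝ f x :=
    (hf.eventually (by simp)).mono fun x hx => hx.differentiableAt two_ne_zero
  obtain ⟨ε, hε, hball⟩ := Metric.eventually_nhds_iff_ball.1 (hdiff.and ht)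
  refine ⟨K + 1, by positivity, ε, hε, fun x hx y hy => ?_⟩
  have hseg : segment ℝ x y ⊆ Metric.ball a ε := (convex_ball a ε).segment_subset hx hy
  have hbound : ∀ z ∈ segment ℝ x y, ‖fderiv ℝ f z - fderiv ℝ f x‖ ≤ K * ‖y - x‖ := fun z hz =>
    (hlip.norm_sub_le (hball z (hseg hz)).2 (hball x hx).2).trans
      (by gcongr; exact norm_sub_le_of_mem_segment hz)
  calc ‖f y - f x - fderiv ℝ f x (y - x)‖ ≤ K * ‖y - x‖ * ‖y - x‖ :=
        (convex_segment x y).norm_image_sub_le_of_norm_fderiv_le'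
          (fun z hz => (hball z (hseg hz)).1) hbound (left_mem_segment ℝ x y)
          (right_mem_segment ℝ x y)
    _ ≤ (K + 1) * ‖y - x‖ ^ 2 := by
        rw [mul_assoc, ← sq]
        gcongr
        exact le_add_of_nonneg_right zero_le_one

theorem exists_sq_le_of_forall_le_quadratic {L B ρ : ℝ} (hL : 0 < L) (hB : 0 < B) (hρ : 0 < ρ) :
    ∃ C > 0, ∀ g η : ℝ, |g| ≤ B → (∀ s, |s| ≤ ρ → 0 ≤ η + s * g + L * s ^ 2) → g ^ 2 ≤ C * η := by
  let α := min (1 / (2 * L)) (ρ / B)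
  have hα : 0 < α := by positivity
  refine ⟨2 / α, by positivity, fun g η hg hη => ?_⟩
  have hstep : |-(α * g)| ≤ ρ := calc
    |-(α * g)| = α * |g| := by rw [abs_neg, abs_mul, abs_of_pos hα]
    _ ≤ ρ / B * B := by gcongr; exact min_le_right _ _
    _ = ρ := div_mul_cancel₀ ρ hB.ne'
  have hαL : α * L ≤ 1 / 2 := calc
    α * L ≤ 1 / (2 * L) * L := by gcongr; exact min_le_left _ _
    _ = 1 / 2 := by field_simp
  have hdecrease : α * g ^ 2 * (1 / 2) ≤ η := calc
    α * g ^ 2 * (1 / 2) ≤ α * g ^ 2 * (1 - α * L) := by gcongr; linarith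
    _ ≤ η := by linarith [hη _ hstep]
  rw [div_mul_eq_mul_div, le_div_iff₀ hα]
  linarith

theorem exists_norm_fderiv_apply_le_sqrt {f : E → ℝ} {a : E} (hf : ContDiffAt ℝ 2 f a) {r : ℝ}
    (hr : 0 < r) : ∃ C > 0, ∀ᶠ x in 𝓝 a, ∀ v η,
      (∀ s : ℝ, ‖s • v‖ ≤ r → f x - η ≤ f (x + s • v)) →
        ‖fderiv ℝ f x v‖ ≤ √(C * η) * ‖v‖ := by
  obtain ⟨L, hL, ε, hε, htaylor⟩ := exists_norm_sub_sub_fderiv_le hf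
  obtain ⟨C, hC, hquad⟩ := exists_sq_le_of_forall_le_quadratic (B := ‖fderiv ℝ f a‖ + 1)
    hL (by positivity) (lt_min hr (half_pos hε))
  have hDf : ∀ᶠ x in 𝓝 a, ‖fderiv ℝ f x‖ < ‖fderiv ℝ f a‖ + 1 :=
    (hf.fderiv_right (m := 0) (by norm_num)).continuousAt.norm.eventually_lt_const
      (lt_add_one _)
  refine ⟨C, hC, ?_⟩
  filter_upwards [hDf, Metric.ball_mem_nhds a (half_pos hε)] with x hx hxa v η hη
  rcases eq_or_ne v 0 with rfl | hv
  · simp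
  have hv' : 0 < ‖v‖ := norm_pos_iff.2 hv
  rw [← div_le_iff₀ hv', ← norm_norm v, ← norm_div]
  refine Real.abs_le_sqrt (hquad _ _ ?_ fun s hs => ?_)
  · rw [abs_div, abs_norm, div_le_iff₀ hv']
    exact ((fderiv ℝ f x).le_opNorm v).trans (by gcongr)
  have hnorm : ‖(s / ‖v‖) • v‖ = |s| := by
    rw [norm_smul, norm_div, norm_norm, div_mul_cancel₀ _ hv'.ne', Real.norm_eq_abs]
  have hmem : x + (s / ‖v‖) • v ∈ Metric.ball a ε := by
    rw [Metric.mem_ball, ← add_halves ε]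
    refine (dist_triangle _ x _).trans_lt (add_lt_add_of_le_of_lt ?_ hxa)
    rw [dist_self_add_left, hnorm]
    exact hs.trans (min_le_right _ _)
  have hupper := (le_abs_self _).trans
    (htaylor x (Metric.ball_subset_ball (half_le_self hε.le) hxa) _ hmem)
  rw [add_sub_cancel_left, hnorm, sq_abs, map_smul, smul_eq_mul, div_mul_comm, mul_comm] at hupper
  linarith [hη (s / ‖v‖) (hnorm.trans_le (hs.trans (min_le_left _ _)))]

end Descent

section CoordinateDescent

variable {σ : Type*} [DecidableEq σ]

theorem opNorm_le_card_mul_of_single [Fintype σ] {D : (σ → ℝ) →L[ℝ] ℝ} {B : ℝ} (hB : 0 ≤ B)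
    (h : ∀ i, ‖D (Pi.single i 1)‖ ≤ B) : ‖D‖ ≤ Fintype.card σ * B := by
  refine D.opNorm_le_bound (by positivity) fun v => ?_
  have hsum : D v = ∑ i, v i • D (Pi.single i 1) := by
    conv_lhs => rw [← Finset.univ_sum_single v, map_sum]
    exact Finset.sum_congr rfl fun i _ => by
      rw [← map_smul, ← Pi.single_smul, smul_eq_mul, mul_one]
  calc ‖D v‖ ≤ ∑ i, ‖v i • D (Pi.single i 1)‖ := hsum ▸ norm_sum_le _ _
    _ ≤ ∑ _i : σ, ‖v‖ * B := Finset.sum_le_sum fun i _ =>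
        (norm_smul_le _ _).trans (mul_le_mul (norm_le_pi_norm v i) (h i) (by positivity)
          (by positivity))
    _ = Fintype.card σ * B * ‖v‖ := by
        rw [Finset.sum_const, Finset.card_univ, nsmul_eq_mul]
        ring

theorem exists_sq_sub_le_of_mem_rationalAt [Finite σ] {f : (σ → ℝ) → ℝ} {a : σ → ℝ}
    (hf : f ∈ rationalAt a) {r : ℝ} (hr : 0 < r) :
    ∃ C > 0, ∀ᶠ x in 𝓝 a, ∀ η, 0 ≤ η →
      (∀ i s, |s| ≤ r → f x - η ≤ f (x + Pi.single i s)) → (f x - f a) ^ 2 ≤ C * η := by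
  have := Fintype.ofFinite σ
  obtain ⟨C, hC, hdescent⟩ :=
    exists_norm_fderiv_apply_le_sqrt (analyticAt_of_mem_rationalAt hf).contDiffAt hr
  have hgrad := (sub_isLittleO_fderiv_of_mem_rationalAt hf).bound one_pos
  refine ⟨Fintype.card σ ^ 2 * C + 1, by positivity, ?_⟩
  filter_upwards [hdescent, hgrad] with x hdescent hgrad η hη hmove
  have hpartial (i : σ) : ‖fderiv ℝ f x (Pi.single i 1)‖ ≤ √(C * η) := by
    refine (hdescent _ η fun s hs => ?_).trans_eq (by simp [Pi.norm_single])
    rw [← Pi.single_smul, smul_eq_mul, mul_one] at hs ⊢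
    exact hmove i s (by simpa [Pi.norm_single] using hs)
  calc (f x - f a) ^ 2 = ‖f x - f a‖ ^ 2 := (sq_abs _).symm
    _ ≤ (Fintype.card σ * √(C * η)) ^ 2 := by
        gcongr
        exact (one_mul ‖fderiv ℝ f x‖ ▸ hgrad).trans
          (opNorm_le_card_mul_of_single (Real.sqrt_nonneg _) hpartial)
    _ = Fintype.card σ ^ 2 * C * η := by
        rw [mul_pow, Real.sq_sqrt (by positivity), mul_assoc]
    _ ≤ (Fintype.card σ ^ 2 * C + 1) * η := by gcongr; exact le_add_of_nonneg_right zero_le_one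

end CoordinateDescent

section AlternatingMinimization

variable {ι : Type} {M : ℕ} {J : (ι → ℝ) → (Fin M → ℝ) → ℝ} {DP : ℕ → ι → ℝ} {T : ℕ → Fin M → ℝ}
  {Dhat : ι → ℝ} {That : Fin M → ℝ}

theorem IsAMRun.isArgminTime (hrun : IsAMRun J DP T) (k : ℕ) : IsArgminTime (J (DP k)) (T k) := by
  cases k with
  | zero => exact hrun.init
  | succ k => exact hrun.stepT k

theorem IsAMRun.succ_le_left (hrun : IsAMRun J DP T) (k : ℕ) (D : ι → ℝ) :
    J (DP (k + 1)) (T (k + 1)) ≤ J D (T k) :=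
  ((hrun.stepT k).2 (hrun.isArgminTime k).1).trans (hrun.stepD k (Set.mem_univ D))

theorem IsAMRun.succ_le_right (hrun : IsAMRun J DP T) (k : ℕ) {T' : Fin M → ℝ}
    (hT' : T' ∈ posTimes M) : J (DP (k + 1)) (T (k + 1)) ≤ J (DP k) T' :=
  (hrun.succ_le_left k (DP k)).trans ((hrun.isArgminTime k).2 hT')

theorem IsAMRun.antitone (hrun : IsAMRun J DP T) : Antitone fun k => J (DP k) (T k) :=
  antitone_nat_of_succ_le fun k => hrun.succ_le_left k (DP k)

theorem tendsto_sumElim {α ι κ X : Type*} [TopologicalSpace X] {l : Filter α} {u : α → ι → X}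
    {v : α → κ → X} {a : ι → X} {b : κ → X} (h : Tendsto (fun k => (u k, v k)) l (𝓝 (a, b))) :
    Tendsto (fun k => Sum.elim (u k) (v k)) l (𝓝 (Sum.elim a b)) :=
  (Homeomorph.sumArrowHomeomorphProdArrow.symm.continuous.tendsto (a, b)).comp h

theorem isOpen_posTimes : IsOpen (posTimes M) := by
  simpa only [posTimes, Set.ofPred_forall] using
    isOpen_iInter_of_finite fun m => isOpen_lt continuous_const (continuous_apply m)

variable [Finite ι]

theorem IsAMRun.exists_sq_sub_le (hrun : IsAMRun J DP T) (hThat : That ∈ posTimes M)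
    (hconv : Tendsto (fun k => (DP k, T k)) atTop (𝓝 (Dhat, That)))
    (hJ : (fun z : ι ⊕ Fin M → ℝ => J (z ∘ Sum.inl) (z ∘ Sum.inr)) ∈
      rationalAt (Sum.elim Dhat That)) :
    ∃ C > 0, ∀ᶠ k in atTop, (J (DP k) (T k) - J Dhat That) ^ 2 ≤
      C * (J (DP k) (T k) - J (DP (k + 1)) (T (k + 1))) := by
  classical
  obtain ⟨r, hr, hball⟩ := Metric.isOpen_iff.1 isOpen_posTimes That hThat
  obtain ⟨C, hC, hsq⟩ := exists_sq_sub_le_of_mem_rationalAt hJ (half_pos hr)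
  refine ⟨C, hC, ?_⟩
  filter_upwards [(tendsto_sumElim hconv).eventually hsq,
    hconv.snd_nhds (Metric.ball_mem_nhds That (half_pos hr))] with k hsq hTk
  simp only [Sum.elim_comp_inl, Sum.elim_comp_inr] at hsq
  refine hsq _ (sub_nonneg.2 (hrun.antitone k.le_succ)) fun i s hs => ?_
  rw [sub_sub_cancel]
  rcases i with e | m
  · convert hrun.succ_le_left k (DP k + Pi.single e s) using 2 <;> ext <;> simp [Pi.single_apply]
  · have hT' : T k + Pi.single m s ∈ posTimes M := by
      refine hball ?_
      rw [← add_halves r]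
      refine (dist_triangle _ (T k) _).trans_lt (add_lt_add_of_le_of_lt ?_ hTk)
      simpa [Pi.norm_single] using hs
    convert hrun.succ_le_right k hT' using 2 <;> ext <;> simp [Pi.single_apply]

theorem IsAMRun.le_of_tendsto (hrun : IsAMRun J DP T)
    (hconv : Tendsto (fun k => (DP k, T k)) atTop (𝓝 (Dhat, That)))
    (hJ : (fun z : ι ⊕ Fin M → ℝ => J (z ∘ Sum.inl) (z ∘ Sum.inr)) ∈
      rationalAt (Sum.elim Dhat That)) (k : ℕ) : J Dhat That ≤ J (DP k) (T k) := by
  have := Fintype.ofFinite ι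
  refine hrun.antitone.le_of_tendsto ?_ k
  simpa [Function.comp_def] using
    (analyticAt_of_mem_rationalAt hJ).continuousAt.tendsto.comp (tendsto_sumElim hconv)

end AlternatingMinimization

section Rate

theorem mul_add_inv_le_inv_of_succ_le_sub_sq {δ : ℕ → ℝ} {c : ℝ} (hc : 0 < c)
    (hstep : ∀ k, δ (k + 1) ≤ δ k - c * δ k ^ 2) (hδ : ∀ k, 0 ≤ δ k) {k : ℕ} (hk : 0 < δ k) :
    c * k + (δ 0)⁻¹ ≤ (δ k)⁻¹ := by
  induction k with
  | zero => simp
  | succ k ih =>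
    have hδk : 0 < δ k := by
      refine (hδ k).lt_of_ne' fun h => ?_
      simpa [h] using hk.trans_le (hstep k)
    have hmul : ((δ k)⁻¹ + c) * δ (k + 1) ≤ 1 := calc
      ((δ k)⁻¹ + c) * δ (k + 1) ≤ ((δ k)⁻¹ + c) * (δ k - c * δ k ^ 2) := by
        gcongr
        exact hstep k
      _ = 1 - (c * δ k) ^ 2 := by field_simp; ring
      _ ≤ 1 := sub_le_self _ (sq_nonneg _)
    calc c * (k + 1 : ℕ) + (δ 0)⁻¹ = c * k + (δ 0)⁻¹ + c := by push_cast; ring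
      _ ≤ (δ k)⁻¹ + c := by gcongr; exact ih hδk
      _ ≤ (δ (k + 1))⁻¹ := by rwa [← one_div (δ (k + 1)), le_div_iff₀ hk]

theorem le_one_div_of_succ_le_sub_sq {δ : ℕ → ℝ} {c : ℝ} (hc : 0 < c)
    (hstep : ∀ k, δ (k + 1) ≤ δ k - c * δ k ^ 2) (hδ : ∀ k, 0 ≤ δ k) (k : ℕ) :
    δ k ≤ 1 / (c * k + (δ 0)⁻¹) := by
  have h0 := hδ 0
  rcases (hδ k).eq_or_lt with hk | hk
  · rw [← hk]
    positivity
  have hanti : Antitone δ := antitone_nat_of_succ_le fun k =>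
    (hstep k).trans (sub_le_self _ (by positivity))
  have hδ0 : 0 < δ 0 := hk.trans_le (hanti k.zero_le)
  rw [le_one_div hk (by positivity), one_div]
  exact mul_add_inv_le_inv_of_succ_le_sub_sq hc hstep hδ hk

theorem exists_le_one_div_of_eventually_sq_le {δ : ℕ → ℝ} {C : ℝ} (hC : 0 < C)
    (hstep : ∀ᶠ k in atTop, δ k ^ 2 ≤ C * (δ k - δ (k + 1))) (hδ : ∀ k, 0 ≤ δ k) :
    ∃ m : ℕ, 0 < m ∧ ∃ γ : ℝ, 0 < γ ∧ ∀ k : ℕ, m ≤ k →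
      δ k ≤ 1 / (γ * ((k : ℝ) - (m : ℝ)) + (δ m)⁻¹) := by
  obtain ⟨m, hm, hm0⟩ := ((eventually_forall_ge_atTop.2 hstep).and (eventually_gt_atTop 0)).exists
  refine ⟨m, hm0, C⁻¹, inv_pos.2 hC, fun k hk => ?_⟩
  obtain ⟨j, rfl⟩ := Nat.exists_eq_add_of_le hk
  have hshift (j : ℕ) : δ (m + (j + 1)) ≤ δ (m + j) - C⁻¹ * δ (m + j) ^ 2 := by
    rw [← add_assoc, le_sub_comm, inv_mul_le_iff₀ hC]
    exact hm (m + j) (m.le_add_right j)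
  simpa using le_one_div_of_succ_le_sub_sq (δ := fun j => δ (m + j)) (inv_pos.2 hC) hshift
    (fun _ => hδ _) j

theorem isBigO_one_div_of_le_one_div {δ : ℕ → ℝ} {γ x b : ℝ} (hγ : γ ≠ 0) (hδ : ∀ k, 0 ≤ δ k)
    (hle : ∀ᶠ k : ℕ in atTop, δ k ≤ 1 / (γ * (k - x) + b)) :
    δ =O[atTop] fun k : ℕ => 1 / (k : ℝ) := by
  have hlin : (fun k : ℕ => (k : ℝ)) =O[atTop] fun k : ℕ => γ * (k - x) + b := by
    have hconst : (fun _ : ℕ => γ * x - b) =o[atTop] fun k : ℕ => γ * (k : ℝ) :=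
      ((Asymptotics.isLittleO_const_id_atTop _).comp_tendsto
        tendsto_natCast_atTop_atTop).trans_isBigO (Asymptotics.isBigO_self_const_mul hγ _ _)
    refine (Asymptotics.isBigO_self_const_mul hγ _ _).trans ?_
    exact hconst.right_isBigO_sub.congr_right fun k => by ring
  have hinv : (fun k : ℕ => 1 / (γ * (k - x) + b)) =O[atTop] fun k : ℕ => 1 / (k : ℝ) := by
    simpa only [one_div] using hlin.inv_rev <| (eventually_ne_atTop 0).mono fun k hk h =>
      absurd h (Nat.cast_ne_zero.2 hk)
  refine .trans (.of_norm_eventuallyLE ?_) hinv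
  filter_upwards [hle] with k hk
  rwa [Real.norm_of_nonneg (hδ k)]

end Rate

section MappingMatrix

theorem expo_injective {S : ℕ} : Function.Injective (expo : Idx S → ℕ) := by
  rintro (i | i) (j | j) h <;> simp only [expo] at h
  · exact congrArg _ (Fin.ext h)
  · have := i.2; lia
  · have := j.2; lia
  · exact congrArg _ (Fin.ext (by lia))

theorem expo_lt {S : ℕ} (c : Idx S) : expo c < S + S := by
  rcases c with i | i <;> simp only [expo] <;> lia

theorem X_sub_C_pow_dvd_of_iterate_derivative_eval_eq_zero {k : Type*} [Field k] [CharZero k]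
    {p : k[X]} {t : k} {n : ℕ} (h : ∀ i < n, (derivative^[i] p).eval t = 0) :
    (X - C t) ^ n ∣ p := by
  by_cases hp : p = 0
  · simp [hp]
  rw [← le_rootMultiplicity_iff hp]
  rcases n with _ | n
  · exact Nat.zero_le _
  · exact lt_rootMultiplicity_of_isRoot_iterate_derivative hp fun m hm => h m (by lia)

theorem eq_zero_of_iterate_derivative_eval_eq_zero {k : Type*} [Field k] [CharZero k] {p : k[X]}
    {s t : k} (hst : s ≠ t) {m n : ℕ} (hdeg : p.degree < (m + n : ℕ))
    (hs : ∀ i < m, (derivative^[i] p).eval s = 0) (ht : ∀ i < n, (derivative^[i] p).eval t = 0) :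
    p = 0 := by
  have hcoprime : IsCoprime ((X - C s) ^ m) ((X - C t) ^ n) :=
    (isCoprime_X_sub_C_of_isUnit_sub (sub_ne_zero.2 hst).isUnit).pow
  refine eq_zero_of_dvd_of_degree_lt (hcoprime.mul_dvd
    (X_sub_C_pow_dvd_of_iterate_derivative_eval_eq_zero hs)
    (X_sub_C_pow_dvd_of_iterate_derivative_eval_eq_zero ht)) ?_
  simpa [degree_X_sub_C] using hdeg

theorem degree_sum_C_mul_X_pow_expo_lt {S : ℕ} (v : Idx S → ℝ) :
    (∑ c, C (v c) * X ^ expo c).degree < ((S + S : ℕ) : WithBot ℕ) := by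
  refine (degree_sum_le _ _).trans_lt ((Finset.sup_lt_iff (WithBot.bot_lt_coe _)).2 fun c _ => ?_)
  exact (degree_C_mul_X_pow_le _ _).trans_lt (by exact_mod_cast expo_lt c)

theorem coeff_sum_C_mul_X_pow_expo {S : ℕ} (v : Idx S → ℝ) (c : Idx S) :
    (∑ c, C (v c) * X ^ expo c).coeff (expo c) = v c := by
  simp only [finsetSum_coeff, coeff_C_mul, coeff_X_pow, expo_injective.eq_iff, mul_ite, mul_one,
    mul_zero, Finset.sum_ite_eq, Finset.mem_univ, if_true]

theorem eval_iterate_derivative_sum_C_mul_X_pow_expo {S : ℕ} (v : Idx S → ℝ) (i : ℕ) (t : ℝ) :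
    (derivative^[i] (∑ c, C (v c) * X ^ expo c)).eval t =
      ∑ c, (derivative^[i] (X ^ expo c : ℝ[X])).eval t * v c := by
  simp only [iterate_derivative_sum, eval_finsetSum, iterate_derivative_C_mul, eval_C_mul]
  exact Finset.sum_congr rfl fun c _ => mul_comm _ _

theorem det_mapMat_ne_zero (S : ℕ) {T : ℝ} (hT : T ≠ 0) : (mapMat S T).det ≠ 0 := by
  intro hdet
  obtain ⟨v, hv, hMv⟩ := Matrix.exists_mulVec_eq_zero_iff.2 hdet
  have hp : ∑ c, C (v c) * X ^ expo c = 0 :=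
    eq_zero_of_iterate_derivative_eval_eq_zero hT.symm (degree_sum_C_mul_X_pow_expo_lt v)
      (fun i hi => (eval_iterate_derivative_sum_C_mul_X_pow_expo v i 0).trans
        (congrFun hMv (Sum.inl ⟨i, hi⟩)))
      (fun i hi => (eval_iterate_derivative_sum_C_mul_X_pow_expo v i T).trans
        (congrFun hMv (Sum.inr ⟨i, hi⟩)))
  exact hv (funext fun c => by rw [← coeff_sum_C_mul_X_pow_expo v c, hp, coeff_zero, Pi.zero_apply])

end MappingMatrix

section CostRational

variable {σ : Type*} {a : σ → ℝ}

/-- Evaluation at `z` as a ring homomorphism on `rationalAt a`, through which polynomials and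
matrices over `rationalAt a` specialize to real ones. The point `z` need not be close to `a`. -/
def rationalAt.eval (z : σ → ℝ) : rationalAt a →+* ℝ :=
  (Pi.evalRingHom (fun _ => ℝ) z).comp (rationalAt a).val.toRingHom

theorem rationalAt.eval_apply (z : σ → ℝ) (g : rationalAt a) : eval z g = g.1 z := rfl

theorem rationalAt.exists_map_eval_eq_inv {n : Type*} [Fintype n] [DecidableEq n]
    {A : Matrix n n (rationalAt a)} (hA : (A.map (eval a)).det ≠ 0) :
    ∃ B : Matrix n n (rationalAt a), ∀ z, B.map (eval z) = (A.map (eval z))⁻¹ := by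
  have hdet (z : σ → ℝ) : (A.map (eval z)).det = A.det.1 z := ((eval z).map_det A).symm
  have hadj (z : σ → ℝ) : A.adjugate.map (eval z) = (A.map (eval z)).adjugate :=
    (eval z).map_adjugate A
  let detInv : rationalAt a := ⟨_, inv_mem_rationalAt A.det.2 (hdet a ▸ hA)⟩
  have hdetInv (z : σ → ℝ) : eval z detInv = (A.det.1 z)⁻¹ := rfl
  refine ⟨detInv • A.adjugate, fun z => ?_⟩
  rw [Matrix.inv_def, Ring.inverse_eq_inv', hdet, ← hdetInv, ← hadj]
  ext i j
  exact map_mul (eval z) detInv (A.adjugate i j)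

theorem rationalAt.integral_eval_map_mem (P : (rationalAt a)[X]) (τ : rationalAt a) :
    (fun z => ∫ t in (0 : ℝ)..τ.1 z, (P.map (eval z)).eval t) ∈ rationalAt a := by
  induction P using Polynomial.induction_on' with
  | add P Q hP hQ =>
    convert add_mem hP hQ using 1
    ext z
    simp only [Polynomial.map_add, eval_add, Pi.add_apply]
    exact intervalIntegral.integral_add ((Polynomial.continuous _).intervalIntegrable _ _)
      ((Polynomial.continuous _).intervalIntegrable _ _)
  | monomial n c =>
    convert ((n + 1 : ℝ)⁻¹ • (c * τ ^ (n + 1))).2 using 1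
    ext z
    simp only [map_monomial, eval_apply, eval_monomial, intervalIntegral.integral_const_mul,
      integral_pow, ne_eq, Nat.add_eq_zero_iff, one_ne_zero, and_false, not_false_eq_true, zero_pow,
      sub_zero, SetLike.val_smul, MulMemClass.coe_mul, SubmonoidClass.coe_pow, Pi.smul_apply,
      Pi.mul_apply, Pi.pow_apply, smul_eq_mul]
    ring

theorem exists_map_eval_eq_mapMat (S : ℕ) (τ : rationalAt a) :
    ∃ A : Matrix (Idx S) (Idx S) (rationalAt a),
      ∀ z, A.map (rationalAt.eval z) = mapMat S (τ.1 z) := by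
  have heval (z : σ → ℝ) (i n : ℕ) (s : rationalAt a) :
      rationalAt.eval z ((derivative^[i] (X ^ n)).eval s) =
        (derivative^[i] (X ^ n : ℝ[X])).eval (s.1 z) := by
    rw [← rationalAt.eval_apply, ← eval_map_apply, ← iterate_derivative_map, Polynomial.map_pow,
      map_X]
  refine ⟨Matrix.of fun r c => match r with
    | Sum.inl i => (derivative^[(i : ℕ)] (X ^ expo c)).eval 0
    | Sum.inr i => (derivative^[(i : ℕ)] (X ^ expo c)).eval τ, fun z => ?_⟩
  ext (i | i) c
  · exact heval z i (expo c) 0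
  · exact heval z i (expo c) τ

theorem exists_map_eval_eq_piecePoly {S : ℕ} (d : Matrix (Idx S) (Fin 3) (rationalAt a))
    {τ : rationalAt a} (hτ : τ.1 a ≠ 0) : ∃ P : Fin 3 → (rationalAt a)[X],
      ∀ z i, (P i).map (rationalAt.eval z) = piecePoly (d.map (rationalAt.eval z)) (τ.1 z) i := by
  obtain ⟨A, hA⟩ := exists_map_eval_eq_mapMat S τ
  obtain ⟨B, hB⟩ := rationalAt.exists_map_eval_eq_inv (hA a ▸ det_mapMat_ne_zero S hτ)
  refine ⟨fun i => ∑ c, C ((B * d) c i) * X ^ expo c, fun z i => ?_⟩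
  simp [piecePoly, ← hA, ← hB, ← Matrix.map_mul, Polynomial.map_sum]

theorem pieceCost_mem_rationalAt {S : ℕ} (W : Weights)
    (d : Matrix (Idx S) (Fin 3) (rationalAt a)) {τ : rationalAt a} (hτ : τ.1 a ≠ 0) :
    (fun z => pieceCost W (d.map (rationalAt.eval z)) (τ.1 z)) ∈ rationalAt a := by
  obtain ⟨P, hP⟩ := exists_map_eval_eq_piecePoly d hτ
  let integrand : (rationalAt a)[X] := C (algebraMap ℝ _ W.rho) + ∑ i ∈ Finset.Icc W.Dmin W.Dmax,
    C (algebraMap ℝ _ (W.w i)) * ∑ j, (derivative^[i] (P j)) ^ 2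
  convert rationalAt.integral_eval_map_mem integrand τ using 2 with z
  simp [pieceCost, integrand, ← hP, eval_finsetSum, Polynomial.map_sum,
    iterate_derivative_map, rationalAt.eval_apply]

theorem cost_mem_rationalAt {S M : ℕ} (W : Weights) (F : Finset (Entry S M))
    (DF : {e // e ∉ F} → ℝ) (Dhat : {e // e ∈ F} → ℝ) {That : Fin M → ℝ}
    (hThat : That ∈ posTimes M) :
    (fun z : {e // e ∈ F} ⊕ Fin M → ℝ => cost W F DF (z ∘ Sum.inl) (z ∘ Sum.inr)) ∈
      rationalAt (Sum.elim Dhat That) := by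
  let τ (m : Fin M) : rationalAt (Sum.elim Dhat That) := ⟨_, coord_mem_rationalAt (Sum.inr m)⟩
  let D (e : Entry S M) : rationalAt (Sum.elim Dhat That) := if h : e ∈ F
    then ⟨_, coord_mem_rationalAt (Sum.inl ⟨e, h⟩)⟩ else algebraMap ℝ _ (DF ⟨e, h⟩)
  have hD (e : Entry S M) (z) : rationalAt.eval z (D e) = assemble F DF (z ∘ Sum.inl) e := by
    by_cases h : e ∈ F <;> simp [D, assemble, h, rationalAt.eval_apply]
  let d (m : Fin M) : Matrix (Idx S) (Fin 3) (rationalAt (Sum.elim Dhat That)) :=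
    Matrix.of fun r j => match r with
      | Sum.inl i => D (m.castSucc, i, j)
      | Sum.inr i => D (m.succ, i, j)
  have hd (m : Fin M) (z) :
      (d m).map (rationalAt.eval z) = boundary (assemble F DF (z ∘ Sum.inl)) m := by
    ext (i | i) j <;> exact hD _ z
  convert sum_mem fun m (_ : m ∈ Finset.univ) =>
    pieceCost_mem_rationalAt W (d m) (τ := τ m) (hThat m).ne' using 1
  ext z
  simp [cost, hd, τ]

end CostRational

end TrajAM

theorem theorem2_general {ι : Type} [Finite ι] {M : ℕ} {J : (ι → ℝ) → (Fin M → ℝ) → ℝ}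
    {DP : ℕ → ι → ℝ} {T : ℕ → Fin M → ℝ} (hrun : TrajAM.IsAMRun J DP T)
    {Dhat : ι → ℝ} {That : Fin M → ℝ} (hThat : That ∈ TrajAM.posTimes M)
    (hconv : Tendsto (fun k => (DP k, T k)) atTop (𝓝 (Dhat, That)))
    (hJ : (fun z : ι ⊕ Fin M → ℝ => J (z ∘ Sum.inl) (z ∘ Sum.inr)) ∈
      TrajAM.rationalAt (Sum.elim Dhat That)) :
    (∃ Kc : ℕ, 0 < Kc ∧ ∃ γ : ℝ, 0 < γ ∧ ∀ K : ℕ, Kc ≤ K →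
      J (DP K) (T K) - J Dhat That
          ≤ 1 / (γ * ((K : ℝ) - (Kc : ℝ)) + (J (DP Kc) (T Kc) - J Dhat That)⁻¹) ∧
      (J (DP Kc) (T Kc) = J Dhat That → J (DP K) (T K) = J Dhat That)) ∧
    (fun K : ℕ => J (DP K) (T K) - J Dhat That) =O[atTop] (fun K : ℕ => 1 / (K : ℝ)) := by
  have hlim := hrun.le_of_tendsto hconv hJ
  have hδ (k : ℕ) : 0 ≤ J (DP k) (T k) - J Dhat That := sub_nonneg.2 (hlim k)
  obtain ⟨C, hC, hdecrease⟩ := hrun.exists_sq_sub_le hThat hconv hJ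
  obtain ⟨Kc, hKc, γ, hγ, hrate⟩ := TrajAM.exists_le_one_div_of_eventually_sq_le hC
    (hdecrease.mono fun k hk => hk.trans_eq (by rw [sub_sub_sub_cancel_right])) hδ
  refine ⟨⟨Kc, hKc, γ, hγ, fun K hK => ⟨hrate K hK, fun hattained => ?_⟩⟩, ?_⟩
  · exact ((hrun.antitone hK).trans_eq hattained).antisymm (hlim K)
  · exact TrajAM.isBigO_one_div_of_le_one_div hγ.ne' hδ ((eventually_ge_atTop Kc).mono hrate)

theorem theorem2 (S M : ℕ) (hS : 1 ≤ S) (hM : 1 ≤ M) (W : TrajAM.Weights)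
    (F : Finset (TrajAM.Entry S M)) (DF : {e // e ∉ F} → ℝ)
    (DP : ℕ → {e // e ∈ F} → ℝ) (T : ℕ → Fin M → ℝ)
    (hrun : TrajAM.IsAMRun (TrajAM.cost W F DF) DP T)
    (Dhat : {e // e ∈ F} → ℝ) (That : Fin M → ℝ)
    (hmin : TrajAM.IsStrictLocalMin (TrajAM.cost W F DF) Dhat That)
    (hconv : Tendsto (fun k => (DP k, T k)) atTop (𝓝 (Dhat, That))) :
    (∃ Kc : ℕ, 0 < Kc ∧ ∃ γ : ℝ, 0 < γ ∧ ∀ K : ℕ, Kc ≤ K →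
      TrajAM.cost W F DF (DP K) (T K) - TrajAM.cost W F DF Dhat That
          ≤ 1 / (γ * ((K : ℝ) - (Kc : ℝ)) +
              (TrajAM.cost W F DF (DP Kc) (T Kc) - TrajAM.cost W F DF Dhat That)⁻¹) ∧
      -- the bound reads `0` if the minimal value is already attained at iteration `Kc`
      (TrajAM.cost W F DF (DP Kc) (T Kc) = TrajAM.cost W F DF Dhat That →
        TrajAM.cost W F DF (DP K) (T K) = TrajAM.cost W F DF Dhat That)) ∧
    (fun K : ℕ => TrajAM.cost W F DF (DP K) (T K) - TrajAM.cost W F DF Dhat That)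
      =O[atTop] (fun K : ℕ => 1 / (K : ℝ)) :=
  theorem2_general hrun hmin.1 hconv (TrajAM.cost_mem_rationalAt W F DF Dhat hmin.1)
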